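/- Let $n,r,K\ge 1$ be integers and $0\le q<p\le 1$. In the planted clustering model, $C_1,\dots,C_r$ are fixed pairwise disjoint subsets of $[n]$ of size $K$ each (so $rK\le n$), and $A\in\{0,1\}^{n\times n}$ is the adjacency matrix (with zero diagonal) of a random graph on $[n]$ in which each pair of distinct nodes is joined by an edge, independently of all other pairs, with probability $p$ if the two nodes lie in the same set $C_m$ and with probability $q$ otherwise. Let $Y^*\in\{0,1\}^{n\times n}$ be the cluster matrix: $Y^*_{ij}=1$ if and only if $i$ and $j$ lie in a common set $C_m$. Write $\|Y\|_*$ for the sum of the singular values of $Y$, and consider the convex program $$\max_{Y\in\mathbb{R}^{n\times n}}\ \sum_{i,j}A_{ij}Y_{ij}\quad\text{subject to}\quad \|Y\|_*\le rK,\qquad \sum_{i,j}Y_{ij}=rK^2,\qquad 0\le Y_{ij}\le 1\ \text{ for all } i,j.$$ Theorem. For every $\epsilon_0\in(0,1)$ there exist constants $c_1,c_2>0$, depending only on $\epsilon_0$, such that the following holds for all $n,r,K,p,q$ and all clusters $C_1,\dots,C_r$ as above. Suppose that $c_1\log n\le K\le n/2$, $q\ge c_1\frac{\log n}{n}$ and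 $p\le 1-\epsilon_0$. If $$K^2(p-q)^2\le c_2\,(Kp+qn),$$ then with probability at least $1-n^{-10}$ the matrix $Y^*$ is not an optimal solution of the convex program above. -/

import Mathlib

open MeasureTheory ProbabilityTheory

noncomputable section

namespace PlantedClustering

/-- `C 0, …, C (r-1)` are pairwise disjoint sets of exactly `K` nodes out of the `n` nodes
`Fin n`; the nodes in none of them are the isolated ones. -/
structure IsClustering {n r : ℕ} (K : ℕ) (C : Fin r → Finset (Fin n)) : Prop where
  card_eq : ∀ m, (C m).card = K
  disjoint : ∀ m m', m ≠ m' → Disjoint (C m) (C m')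

/-- The nodes `i` and `j` belong to a common cluster. -/
def SameCluster {n r : ℕ} (C : Fin r → Finset (Fin n)) (i j : Fin n) : Prop :=
  ∃ m, i ∈ C m ∧ j ∈ C m

open Classical in
/-- The cluster matrix `Y*`: its `(i, j)` entry is `1` if `i` and `j` are in a common cluster
and `0` otherwise (in particular `Y* i i = 1` exactly for the non-isolated nodes `i`). -/
def clusterMatrix {n r : ℕ} (C : Fin r → Finset (Fin n)) : Matrix (Fin n) (Fin n) ℝ :=
  Matrix.of fun i j => if SameCluster C i j then 1 else 0

open Classical in
/-- The random graph `G` on `Fin n` follows the planted clustering model with clusters `C`,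
in-cluster edge density `p` and cross-cluster edge density `q`: the edges are present
independently over all unordered pairs of distinct nodes, with probability `p` for two nodes in
a common cluster and `q` for all other pairs. -/
structure IsPlantedGraph {Ω : Type*} [MeasurableSpace Ω] (μ : Measure Ω) {n r : ℕ}
    (C : Fin r → Finset (Fin n)) (p q : ℝ) (G : Ω → SimpleGraph (Fin n)) : Prop where
  measurableSet_adj : ∀ i j, MeasurableSet {ω | (G ω).Adj i j}
  indep : iIndepSet
    (fun e : {e : Fin n × Fin n // e.1 < e.2} => {ω | (G ω).Adj e.1.1 e.1.2}) μ
  prob_adj : ∀ i j, i < j →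
    μ.real {ω | (G ω).Adj i j} = if SameCluster C i j then p else q

open Classical in
/-- The 0-1 adjacency matrix of a graph; its diagonal is zero. -/
def adjacency {n : ℕ} (G : SimpleGraph (Fin n)) : Matrix (Fin n) (Fin n) ℝ :=
  G.adjMatrix ℝ

/-- The trace norm (nuclear norm) of a square matrix: the sum of its `n` singular values,
counted with multiplicity. -/
def traceNorm {n : ℕ} (Y : Matrix (Fin n) (Fin n) ℝ) : ℝ :=
  ∑ i ∈ Finset.range n, (Matrix.toEuclideanLin Y).singularValues i

/-- The feasible set of the convex relaxation. -/
def feasibleSet (n r K : ℕ) : Set (Matrix (Fin n) (Fin n) ℝ) :=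
  {Y | traceNorm Y ≤ (r : ℝ) * K ∧ ∑ i, ∑ j, Y i j = (r : ℝ) * (K : ℝ) ^ 2 ∧
    ∀ i j, 0 ≤ Y i j ∧ Y i j ≤ 1}

/-- The objective `∑ i j, A i j * Y i j` of the convex relaxation. -/
def objective {n : ℕ} (A Y : Matrix (Fin n) (Fin n) ℝ) : ℝ :=
  ∑ i, ∑ j, A i j * Y i j

/-- `Y` is an optimal solution of the convex relaxation with input matrix `A`. -/
def IsOptimalSolution {n : ℕ} (r K : ℕ) (A Y : Matrix (Fin n) (Fin n) ℝ) : Prop :=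
  Y ∈ feasibleSet n r K ∧ ∀ Y' ∈ feasibleSet n r K, objective A Y' ≤ objective A Y

end PlantedClustering

end

/-!
The cluster matrix `Y*` is beaten by a feasible matrix `Y* + ε H` with `ε` small, where
`H = a (J - Y*) - Y* + t A'`; here `J` is the all-ones matrix and `A'` the part of `A` off the
clusters. Write `R = rK`, `M = n² - RK` for the number of entries off the clusters,
`N` for the sum of `A'` and `S = ⟨A, Y*⟩`. The sum constraint reads `a M + t N = RK`, and the
objective increases iff `(a + t) N > S`.

*Trace norm.* `Y* = K P` with `P` an orthogonal projection of rank `r`. Writing the trace norm as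
`⟨W, Y⟩` with a contraction `W` (`exists_contraction_traceNorm_eq`), one sees that if `⟨W, P⟩` falls
short of `r` by `d`, then `W` is within `O(√d)` of `P + (1 - P) W (1 - P)` in Frobenius norm, while
`⟨W, K P⟩` drops by `K d`. Hence the trace norm of `Y* + ε H` is at most
`R + ε (⟨P, H⟩ + sup_W ⟨(1 - P) W (1 - P), H⟩) + O(ε²)` (`traceNorm_smul_add_smul_le`).
Here `⟨P, H⟩ = -R`, the term of `J` contributes at most `a (n - R)` because `(1 - P) 1` is the
indicator vector of the isolated nodes, and the term of `A'` contributes at most `t √(n N)` by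
Cauchy–Schwarz (`trace_mul_direction_le`). So it suffices that `a (n - R) + t √(n N) < R`
(`not_isOptimalSolution_of_direction`).

*Choice of rates.* The first summand is always at most `R / 2`, so `t` can be taken with
`t N = min (RK) (R √(N / n) / 4)`. With edge densities `S / (RK)` and `N / M` inside and off the
clusters, the objective then increases as soon as
`K (S / (RK) - N / M) < √(N / n) / 4 * (1 - N / M)` (`exists_rates`). The left side is about
`K (p - q)` and the right side of order `√(qn)`, so this is the hypothesis of the theorem, up to the
term `Kp`, which is dominated by `qn` in this regime (`gap_le_of_sq_le`). Chernoff bounds for `S` and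
`N` with parameter `θ` of order `1 / √(qn)` make the deviations a small multiple of `√(qn)`
(`edge_density_estimates`), each with failure probability `n⁻¹¹`.
-/

namespace PlantedClustering

/-! ### Trace norm and contractions -/

/-- `W` is a contraction for the Euclidean norm, i.e. its operator norm is at most `1`. -/
def IsContraction {n : ℕ} (W : Matrix (Fin n) (Fin n) ℝ) : Prop :=
  ∀ x : Fin n → ℝ, W.mulVec x ⬝ᵥ W.mulVec x ≤ x ⬝ᵥ x

/-- The squared Frobenius norm. -/
def frobSq {n : ℕ} (B : Matrix (Fin n) (Fin n) ℝ) : ℝ := (B.transpose * B).trace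

/-- Half of the duality between trace norm and operator norm: the trace norm is attained as
`⟨W, Y⟩` at a contraction `W`, namely at the partial isometry of the polar decomposition
of `Y`. -/
lemma exists_contraction_traceNorm_eq {n : ℕ} (Y : Matrix (Fin n) (Fin n) ℝ) :
    ∃ W : Matrix (Fin n) (Fin n) ℝ, IsContraction W ∧
      traceNorm Y = (W.transpose * Y).trace := by
  classical
  set T := Matrix.toEuclideanLin Y with hTdef
  have hn : Module.finrank ℝ (EuclideanSpace ℝ (Fin n)) = n := by simp
  set hS := T.isSymmetric_adjoint_comp_self with hSdef
  set b := hS.eigenvectorBasis hn with hb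
  set σ : Fin n → ℝ := fun i => T.singularValues i with hσ
  have hσnn : ∀ i, 0 ≤ σ i := fun i => T.singularValues_nonneg i
  have hinner : ∀ i j, inner ℝ (T (b i)) (T (b j)) = if i = j then σ i ^ 2 else 0 := by
    intro i j
    have h1 := hS.apply_eigenvectorBasis hn i
    rw [← LinearMap.adjoint_inner_left]
    have h2 : (LinearMap.adjoint T) (T (b i)) = (σ i ^ 2) • b i := by
      rw [hσ, T.sq_singularValues_fin hn i]
      exact h1
    rw [h2, inner_smul_left, orthonormal_iff_ite.mp b.orthonormal i j]
    simp
  -- `(σ i)⁻¹ = 0` for a vanishing singular value, so such a direction is sent to `0`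
  set y : Fin n → EuclideanSpace ℝ (Fin n) := fun i => (σ i)⁻¹ • T (b i) with hy
  have hyy : ∀ i j, inner ℝ (y i) (y j) = if i = j then (if σ i = 0 then 0 else 1) else (0 : ℝ) := by
    intro i j
    simp only [hy, inner_smul_left, inner_smul_right, hinner]
    by_cases hij : i = j
    · subst hij
      by_cases h0 : σ i = 0
      · simp [h0]
      · simp [h0]; field_simp
    · simp [hij]
  set Wl : EuclideanSpace ℝ (Fin n) →ₗ[ℝ] EuclideanSpace ℝ (Fin n) :=
    b.toBasis.constr ℝ y with hWl
  have hWb : ∀ i, Wl (b i) = y i := by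
    intro i
    rw [hWl, ← b.coe_toBasis]
    exact b.toBasis.constr_basis ℝ y i
  have hWx : ∀ x, Wl x = ∑ i, inner ℝ (b i) x • y i := by
    intro x
    conv_lhs => rw [← b.sum_repr' x]
    simp [hWb]
  set W := Matrix.toEuclideanLin.symm Wl with hW
  have hWW : Matrix.toEuclideanLin W = Wl := by simp [hW]
  refine ⟨W, ?_, ?_⟩
  · intro x
    have h1 : inner ℝ (Wl (WithLp.toLp 2 x)) (Wl (WithLp.toLp 2 x))
        ≤ inner ℝ (WithLp.toLp 2 x) (WithLp.toLp 2 x) := by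
      generalize WithLp.toLp 2 x = z
      rw [hWx z, ← b.sum_inner_mul_inner z z, sum_inner]
      refine Finset.sum_le_sum fun i _ => ?_
      simp only [inner_sum, inner_smul_left, inner_smul_right, hyy]
      simp only [mul_ite, mul_zero, Finset.sum_ite_eq, Finset.mem_univ, if_true]
      rw [real_inner_comm z (b i)]
      split_ifs
      · exact mul_self_nonneg _
      · simp
    rw [← hWW] at h1
    simp only [Matrix.toLpLin_toLp, Matrix.toLin'_apply, EuclideanSpace.inner_toLp_toLp,
      star_trivial] at h1
    exact h1
  · have e1 := LinearMap.trace_eq_sum_inner (LinearMap.adjoint Wl ∘ₗ T) b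
    have e2 := LinearMap.trace_eq_sum_inner (LinearMap.adjoint Wl ∘ₗ T)
      (EuclideanSpace.basisFun (Fin n) ℝ)
    rw [e1] at e2
    simp only [LinearMap.comp_apply, LinearMap.adjoint_inner_right, hWb] at e2
    have e3 : ∑ i, inner ℝ (y i) (T (b i)) = traceNorm Y := by
      rw [traceNorm, Finset.sum_range]
      refine Finset.sum_congr rfl fun i _ => ?_
      simp only [hy, inner_smul_left, hinner, if_true]
      change _ = σ i
      by_cases h0 : σ i = 0
      · simp [h0]
      · simp; field_simp
    rw [← e3, e2]
    simp only [Matrix.trace, Matrix.diag, Matrix.mul_apply, Matrix.transpose_apply]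
    refine Finset.sum_congr rfl fun i _ => ?_
    rw [← hWW, hTdef]
    simp [PiLp.inner_apply, Matrix.toLpLin_apply, mul_comm]

lemma trace_transpose_mul_eq_sum {n : ℕ} (A B : Matrix (Fin n) (Fin n) ℝ) :
    (A.transpose * B).trace = ∑ i, ∑ j, A i j * B i j := by
  simp only [Matrix.trace, Matrix.diag, Matrix.mul_apply, Matrix.transpose_apply]
  exact Finset.sum_comm

lemma frobSq_eq_sum {n : ℕ} (B : Matrix (Fin n) (Fin n) ℝ) :
    frobSq B = ∑ i, ∑ j, B i j ^ 2 := by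
  simp [frobSq, trace_transpose_mul_eq_sum, sq]

lemma frobSq_nonneg {n : ℕ} (B : Matrix (Fin n) (Fin n) ℝ) : 0 ≤ frobSq B := by
  rw [frobSq_eq_sum]; positivity

lemma frobSq_transpose {n : ℕ} (B : Matrix (Fin n) (Fin n) ℝ) :
    frobSq B.transpose = frobSq B := by
  rw [frobSq_eq_sum, frobSq_eq_sum]
  exact Finset.sum_comm

/-- The Cauchy–Schwarz inequality for the Frobenius inner product. -/
lemma trace_transpose_mul_le {n : ℕ} (A B : Matrix (Fin n) (Fin n) ℝ) :
    (A.transpose * B).trace ≤ √(frobSq A) * √(frobSq B) := by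
  rw [trace_transpose_mul_eq_sum, frobSq_eq_sum, frobSq_eq_sum]
  simp only [← Finset.sum_product']
  exact Real.sum_mul_le_sqrt_mul_sqrt _ _ _

namespace IsContraction

variable {n : ℕ} {V W : Matrix (Fin n) (Fin n) ℝ}

protected lemma mul (hV : IsContraction V) (hW : IsContraction W) : IsContraction (V * W) := by
  intro x
  rw [← Matrix.mulVec_mulVec]
  exact (hV _).trans (hW _)

protected lemma transpose (hW : IsContraction W) : IsContraction W.transpose := by
  intro x
  set u := W.transpose.mulVec x with hu
  have h1 : u ⬝ᵥ u = x ⬝ᵥ W.mulVec u := by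
    rw [Matrix.dotProduct_mulVec, ← Matrix.mulVec_transpose, Matrix.transpose_transpose,
      dotProduct_comm]
  have h2 : (x ⬝ᵥ W.mulVec u) ^ 2 ≤ (x ⬝ᵥ x) * (W.mulVec u ⬝ᵥ W.mulVec u) := by
    simpa [dotProduct, sq] using
      Finset.sum_mul_sq_le_sq_mul_sq Finset.univ x (W.mulVec u)
  have hxx : 0 ≤ x ⬝ᵥ x := Finset.sum_nonneg fun i _ => mul_self_nonneg _
  have h3 : (u ⬝ᵥ u) ^ 2 ≤ (x ⬝ᵥ x) * (u ⬝ᵥ u) := by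
    rw [h1]
    refine h2.trans (mul_le_mul_of_nonneg_left ?_ hxx)
    rw [← h1]; exact hW u
  by_contra hcon
  push Not at hcon
  nlinarith

lemma frobSq_mul_le (hW : IsContraction W) (B : Matrix (Fin n) (Fin n) ℝ) :
    frobSq (W * B) ≤ frobSq B := by
  rw [frobSq_eq_sum, frobSq_eq_sum, Finset.sum_comm, Finset.sum_comm (f := fun i j => B i j ^ 2)]
  refine Finset.sum_le_sum fun j _ => ?_
  simpa [Matrix.mulVec, Matrix.mul_apply, dotProduct, sq] using hW (fun i => B i j)

lemma frobSq_mul_le' (hW : IsContraction W) (B : Matrix (Fin n) (Fin n) ℝ) :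
    frobSq (B * W) ≤ frobSq B := by
  rw [← frobSq_transpose, Matrix.transpose_mul, ← frobSq_transpose B]
  exact hW.transpose.frobSq_mul_le _

lemma frobSq_le (hW : IsContraction W) : frobSq W ≤ n := by
  have := hW.frobSq_mul_le 1
  simpa [frobSq] using this

lemma dotProduct_mulVec_le (hW : IsContraction W) (x : Fin n → ℝ) : x ⬝ᵥ W.mulVec x ≤ x ⬝ᵥ x := by
  have h1 := hW x
  have h2 : 0 ≤ (x - W.mulVec x) ⬝ᵥ (x - W.mulVec x) :=
    Finset.sum_nonneg fun i _ => mul_self_nonneg _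
  rw [sub_dotProduct, dotProduct_sub, dotProduct_sub, dotProduct_comm (W.mulVec x) x] at h2
  linarith

end IsContraction

/-- A complement of an orthogonal projection is a contraction. -/
lemma isContraction_one_sub {n : ℕ} {P : Matrix (Fin n) (Fin n) ℝ} (hPt : P.transpose = P)
    (hPP : P * P = P) : IsContraction (1 - P) := by
  intro x
  have h1 : P.mulVec x ⬝ᵥ P.mulVec x = x ⬝ᵥ P.mulVec x := by
    conv_lhs => rw [Matrix.dotProduct_mulVec, ← Matrix.mulVec_transpose, hPt,
      Matrix.mulVec_mulVec, hPP, dotProduct_comm]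
  have h2 : 0 ≤ P.mulVec x ⬝ᵥ P.mulVec x := Finset.sum_nonneg fun i _ => mul_self_nonneg _
  rw [Matrix.sub_mulVec, Matrix.one_mulVec, sub_dotProduct, dotProduct_sub, dotProduct_sub,
    dotProduct_comm (P.mulVec x) x]
  linarith

/-- A contraction `W` agrees with `P + (1 - P) W (1 - P)` up to an error of Frobenius norm
`O(√(tr P - ⟨W, P⟩))`. -/
lemma trace_transpose_mul_le_of_isContraction {n : ℕ} {P W H : Matrix (Fin n) (Fin n) ℝ}
    (hPt : P.transpose = P) (hPP : P * P = P) (hW : IsContraction W) :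
    (W.transpose * P).trace ≤ P.trace ∧
    (W.transpose * H).trace ≤ (P * H).trace
      + (((1 - P) * W * (1 - P)).transpose * H).trace
      + 2 * √(2 * (P.trace - (W.transpose * P).trace)) * √(frobSq H) := by
  set d := P.trace - (W.transpose * P).trace with hd
  have hPf : frobSq P = P.trace := by rw [frobSq, hPt, hPP]
  have hQ := isContraction_one_sub hPt hPP
  have hWt : (W * P).trace = (W.transpose * P).trace := by
    rw [← Matrix.trace_transpose (W * P), Matrix.transpose_mul, hPt, Matrix.trace_mul_comm]
  have hl : frobSq (P * W - P) ≤ 2 * d := by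
    have h1 : frobSq (P * W) ≤ P.trace := hPf ▸ hW.frobSq_mul_le' P
    have h2 : frobSq (P * W - P)
        = frobSq (P * W) - 2 * (W.transpose * P).trace + P.trace := by
      have e : (P * W - P).transpose * (P * W - P)
          = (P * W).transpose * (P * W) - W.transpose * (P * P) - P * P * W + P * P := by
        simp only [Matrix.transpose_sub, Matrix.transpose_mul, hPt]
        noncomm_ring
      rw [frobSq, frobSq, e, hPP, Matrix.trace_add, Matrix.trace_sub, Matrix.trace_sub,
        Matrix.trace_mul_comm P W, hWt]
      ring
    linarith
  have hr : frobSq (W * P - P) ≤ 2 * d := by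
    have h1 : frobSq (W * P) ≤ P.trace := hPf ▸ hW.frobSq_mul_le P
    have h2 : frobSq (W * P - P)
        = frobSq (W * P) - 2 * (W.transpose * P).trace + P.trace := by
      have e : (W * P - P).transpose * (W * P - P)
          = (W * P).transpose * (W * P) - P * W.transpose * P - P * W * P + P * P := by
        simp only [Matrix.transpose_sub, Matrix.transpose_mul, hPt]
        noncomm_ring
      rw [frobSq, frobSq, e, hPP, Matrix.trace_add, Matrix.trace_sub, Matrix.trace_sub,
        Matrix.mul_assoc P, Matrix.mul_assoc P, Matrix.trace_mul_comm P, Matrix.trace_mul_comm P,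
        Matrix.mul_assoc, Matrix.mul_assoc, hPP, hWt]
      ring
    linarith
  have hdnn : 0 ≤ d := by linarith [frobSq_nonneg (P * W - P)]
  refine ⟨by linarith, ?_⟩
  have e : W = P + (1 - P) * W * (1 - P) + (P * W - P) + (1 - P) * (W * P - P) := by
    have : (1 - P) * (W * P - P) = W * P - P - P * W * P + P * P := by noncomm_ring
    rw [this, hPP]; noncomm_ring
  have hr' : frobSq ((1 - P) * (W * P - P)) ≤ 2 * d := (hQ.frobSq_mul_le _).trans hr
  have c1 := (trace_transpose_mul_le (P * W - P) H).trans
    (mul_le_mul_of_nonneg_right (Real.sqrt_le_sqrt hl) (Real.sqrt_nonneg _))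
  have c2 := (trace_transpose_mul_le ((1 - P) * (W * P - P)) H).trans
    (mul_le_mul_of_nonneg_right (Real.sqrt_le_sqrt hr') (Real.sqrt_nonneg _))
  have e4 : (W.transpose * H).trace = (P * H).trace
      + (((1 - P) * W * (1 - P)).transpose * H).trace
      + ((P * W - P).transpose * H).trace + (((1 - P) * (W * P - P)).transpose * H).trace := by
    conv_lhs => rw [e]
    simp only [Matrix.transpose_add, Matrix.add_mul, Matrix.trace_add, hPt]
  linarith

/-- First-order upper bound, with an explicit quadratic error term, for the trace norm near a
positive multiple `k P` of an orthogonal projection `P`. -/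
lemma traceNorm_smul_add_smul_le {n : ℕ} {P H : Matrix (Fin n) (Fin n) ℝ} {k ε m : ℝ}
    (hPt : P.transpose = P) (hPP : P * P = P) (hk : 0 < k) (hε : 0 ≤ ε)
    (hm : ∀ W, IsContraction W → (P * H).trace
      + (((1 - P) * W * (1 - P)).transpose * H).trace ≤ m) :
    traceNorm (k • P + ε • H) ≤ k * P.trace + ε * m + 2 * ε ^ 2 * frobSq H / k := by
  obtain ⟨W, hW, hY⟩ := exists_contraction_traceNorm_eq (k • P + ε • H)
  obtain ⟨h1, h2⟩ := trace_transpose_mul_le_of_isContraction (H := H) hPt hPP hW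
  have h3 := hm W hW
  set s := √(2 * (P.trace - (W.transpose * P).trace)) with hs
  have hs2 : s ^ 2 = 2 * (P.trace - (W.transpose * P).trace) := Real.sq_sqrt (by linarith)
  set f := √(frobSq H) with hf
  have hf2 : f ^ 2 = frobSq H := Real.sq_sqrt (frobSq_nonneg H)
  rw [hY, Matrix.mul_add, Matrix.trace_add, Matrix.mul_smul, Matrix.mul_smul, Matrix.trace_smul,
    Matrix.trace_smul, smul_eq_mul, smul_eq_mul, ← hf2]
  have h4 : ε * (W.transpose * H).trace ≤ ε * (m + 2 * s * f) :=
    mul_le_mul_of_nonneg_left (by linarith) hε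
  have h5 : 2 * ε * s * f ≤ k * s ^ 2 / 2 + 2 * ε ^ 2 * f ^ 2 / k := by
    have : k * s ^ 2 / 2 + 2 * ε ^ 2 * f ^ 2 / k - 2 * ε * s * f
        = (k * s - 2 * ε * f) ^ 2 / (2 * k) := by field_simp; ring
    have : 0 ≤ (k * s - 2 * ε * f) ^ 2 / (2 * k) := by positivity
    linarith
  have h6 : k * (W.transpose * P).trace = k * P.trace - k * s ^ 2 / 2 := by rw [hs2]; ring
  linarith

/-! ### The cluster matrix -/

lemma clusterMatrix_of_sameCluster {n r : ℕ} {C : Fin r → Finset (Fin n)} {i j : Fin n}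
    (h : SameCluster C i j) : clusterMatrix C i j = 1 := by
  simp only [clusterMatrix, Matrix.of_apply, if_pos h]

lemma clusterMatrix_of_not_sameCluster {n r : ℕ} {C : Fin r → Finset (Fin n)} {i j : Fin n}
    (h : ¬ SameCluster C i j) : clusterMatrix C i j = 0 := by
  simp only [clusterMatrix, Matrix.of_apply, if_neg h]

open Classical in
lemma clusterMatrix_eq_sum {n r K : ℕ} {C : Fin r → Finset (Fin n)} (hC : IsClustering K C)
    (i j : Fin n) : clusterMatrix C i j =
      ∑ m, (if i ∈ C m then (1 : ℝ) else 0) * (if j ∈ C m then 1 else 0) := by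
  by_cases h : SameCluster C i j
  · rw [clusterMatrix_of_sameCluster h]
    obtain ⟨m, hi, hj⟩ := h
    rw [Finset.sum_eq_single m]
    · simp [hi, hj]
    · intro m' _ hm'
      have := Finset.disjoint_left.mp (hC.disjoint m m' (Ne.symm hm')) hi
      simp [this]
    · simp
  · rw [clusterMatrix_of_not_sameCluster h]
    symm
    refine Finset.sum_eq_zero fun m _ => ?_
    by_cases hi : i ∈ C m
    · have : j ∉ C m := fun hj => h ⟨m, hi, hj⟩
      simp [this]
    · simp [hi]

open Classical in
lemma IsClustering.sum_ite {n r K : ℕ} {C : Fin r → Finset (Fin n)} (hC : IsClustering K C)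
    (m : Fin r) : ∑ i, (if i ∈ C m then (1 : ℝ) else 0) = K := by
  simp [hC.card_eq m]

lemma clusterMatrix_eq_zero_or_one {n r : ℕ} (C : Fin r → Finset (Fin n)) (i j : Fin n) :
    clusterMatrix C i j = 0 ∨ clusterMatrix C i j = 1 := by
  by_cases h : SameCluster C i j
  · exact Or.inr (clusterMatrix_of_sameCluster h)
  · exact Or.inl (clusterMatrix_of_not_sameCluster h)

lemma clusterMatrix_transpose {n r : ℕ} (C : Fin r → Finset (Fin n)) :
    (clusterMatrix C).transpose = clusterMatrix C := by
  ext i j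
  have : SameCluster C j i ↔ SameCluster C i j := by simp only [SameCluster, and_comm]
  rw [Matrix.transpose_apply]
  by_cases h : SameCluster C i j
  · rw [clusterMatrix_of_sameCluster h, clusterMatrix_of_sameCluster (this.mpr h)]
  · rw [clusterMatrix_of_not_sameCluster h, clusterMatrix_of_not_sameCluster (this.not.mpr h)]

lemma clusterMatrix_mul_self {n r K : ℕ} {C : Fin r → Finset (Fin n)} (hC : IsClustering K C) :
    clusterMatrix C * clusterMatrix C = (K : ℝ) • clusterMatrix C := by
  classical
  ext i j
  rw [Matrix.mul_apply, Matrix.smul_apply, smul_eq_mul]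
  have h1 : ∀ k, clusterMatrix C i k * clusterMatrix C k j
      = ∑ m, ((if i ∈ C m then (1 : ℝ) else 0) * (if j ∈ C m then 1 else 0)) *
          (if k ∈ C m then 1 else 0) := by
    intro k
    rw [clusterMatrix_eq_sum hC i k, Finset.sum_mul]
    refine Finset.sum_congr rfl fun m _ => ?_
    by_cases hk : k ∈ C m
    · have : clusterMatrix C k j = if j ∈ C m then 1 else 0 := by
        rw [clusterMatrix_eq_sum hC, Finset.sum_eq_single m]
        · simp [hk]
        · intro m' _ hm'
          have := Finset.disjoint_left.mp (hC.disjoint m m' (Ne.symm hm')) hk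
          simp [this]
        · simp
      rw [this]; simp [hk]
    · simp [hk]
  simp only [h1]
  rw [Finset.sum_comm, clusterMatrix_eq_sum hC, Finset.mul_sum]
  refine Finset.sum_congr rfl fun m _ => ?_
  rw [← Finset.mul_sum, hC.sum_ite, mul_comm]

lemma sum_clusterMatrix {n r K : ℕ} {C : Fin r → Finset (Fin n)} (hC : IsClustering K C) :
    ∑ i, ∑ j, clusterMatrix C i j = r * (K : ℝ) ^ 2 := by
  classical
  simp only [clusterMatrix_eq_sum hC]
  have h : ∀ i : Fin n, ∑ j, ∑ m, (if i ∈ C m then (1 : ℝ) else 0) * (if j ∈ C m then 1 else 0)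
      = ∑ m, (if i ∈ C m then (1 : ℝ) else 0) * K := by
    intro i
    rw [Finset.sum_comm]
    refine Finset.sum_congr rfl fun m _ => ?_
    rw [← Finset.mul_sum, hC.sum_ite]
  simp only [h]
  rw [Finset.sum_comm]
  simp only [← Finset.sum_mul, hC.sum_ite]
  simp; ring

lemma trace_clusterMatrix {n r K : ℕ} {C : Fin r → Finset (Fin n)} (hC : IsClustering K C) :
    (clusterMatrix C).trace = r * (K : ℝ) := by
  classical
  simp only [Matrix.trace, Matrix.diag, clusterMatrix_eq_sum hC]
  rw [Finset.sum_comm]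
  have h : ∀ m, ∑ i, (if i ∈ C m then (1 : ℝ) else 0) * (if i ∈ C m then 1 else 0) = K := by
    intro m
    rw [← hC.sum_ite m]
    exact Finset.sum_congr rfl fun i _ => by split_ifs <;> simp
  rw [Finset.sum_congr rfl fun m _ => h m]
  simp

/-- The clusters fit into the `n` nodes. -/
lemma IsClustering.mul_le {n r K : ℕ} {C : Fin r → Finset (Fin n)} (hC : IsClustering K C) :
    (r : ℝ) * K ≤ n := by
  rw [← trace_clusterMatrix hC, Matrix.trace]
  calc ∑ i, (clusterMatrix C).diag i ≤ ∑ _i : Fin n, (1 : ℝ) :=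
        Finset.sum_le_sum fun i _ => by
          rcases clusterMatrix_eq_zero_or_one C i i with h | h <;> simp [Matrix.diag, h]
    _ = n := by simp

/-! ### Improving on the cluster matrix -/

/-- The part of `A` outside the clusters' diagonal blocks. -/
noncomputable def offCluster {n r : ℕ} (C : Fin r → Finset (Fin n)) (A : Matrix (Fin n) (Fin n) ℝ) :
    Matrix (Fin n) (Fin n) ℝ :=
  Matrix.of fun i j => A i j * (1 - clusterMatrix C i j)

/-- The improving direction: decrease the cluster matrix at unit rate, increase all entries off
the clusters at rate `a`, and increase in addition at rate `t` those entries that are edges. -/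
noncomputable def direction {n r : ℕ} (C : Fin r → Finset (Fin n))
    (A : Matrix (Fin n) (Fin n) ℝ) (a t : ℝ) : Matrix (Fin n) (Fin n) ℝ :=
  Matrix.of fun i j =>
    a * (1 - clusterMatrix C i j) - clusterMatrix C i j + t * offCluster C A i j

section

variable {n r K : ℕ} {C : Fin r → Finset (Fin n)} {A : Matrix (Fin n) (Fin n) ℝ} {a t : ℝ}

lemma offCluster_sq (hA : ∀ i j, A i j = 0 ∨ A i j = 1) (i j : Fin n) :
    offCluster C A i j ^ 2 = offCluster C A i j := by
  rcases hA i j with h | h <;> rcases clusterMatrix_eq_zero_or_one C i j with h' | h' <;>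
    simp [offCluster, h, h']

lemma sum_mul_direction (V : Matrix (Fin n) (Fin n) ℝ) :
    ∑ i, ∑ j, V i j * direction C A a t i j
      = a * (∑ i, ∑ j, V i j) - (a + 1) * (∑ i, ∑ j, V i j * clusterMatrix C i j)
        + t * ∑ i, ∑ j, V i j * offCluster C A i j := by
  simp only [Finset.mul_sum, ← Finset.sum_sub_distrib, ← Finset.sum_add_distrib]
  refine Finset.sum_congr rfl fun i _ => Finset.sum_congr rfl fun j _ => ?_
  simp only [direction, Matrix.of_apply]
  ring

lemma sum_direction (hC : IsClustering K C) :
    ∑ i, ∑ j, direction C A a t i j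
      = a * ((n : ℝ) ^ 2 - r * K ^ 2) - r * K ^ 2 + t * ∑ i, ∑ j, offCluster C A i j := by
  have h := sum_mul_direction (C := C) (A := A) (a := a) (t := t) (Matrix.of fun _ _ => 1)
  simp only [Matrix.of_apply, one_mul, sum_clusterMatrix hC] at h
  rw [h]
  simp
  ring

lemma sum_clusterMatrix_mul_direction (hC : IsClustering K C) :
    ∑ i, ∑ j, clusterMatrix C i j * direction C A a t i j = -(r * (K : ℝ) ^ 2) := by
  rw [← sum_clusterMatrix hC, ← Finset.sum_neg_distrib]
  refine Finset.sum_congr rfl fun i _ => ?_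
  rw [← Finset.sum_neg_distrib]
  refine Finset.sum_congr rfl fun j _ => ?_
  rcases clusterMatrix_eq_zero_or_one C i j with h | h <;> simp [direction, offCluster, h]

lemma objective_direction (hA : ∀ i j, A i j = 0 ∨ A i j = 1) :
    objective A (direction C A a t)
      = (a + t) * (∑ i, ∑ j, offCluster C A i j) - objective A (clusterMatrix C) := by
  simp only [objective, Finset.mul_sum, ← Finset.sum_sub_distrib]
  refine Finset.sum_congr rfl fun i _ => Finset.sum_congr rfl fun j _ => ?_
  rcases hA i j with h | h <;> simp [direction, offCluster, h]
  ring

/-- The normalized cluster matrix is an orthogonal projection. -/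
lemma smul_clusterMatrix_mul_self (hC : IsClustering K C) (hK : 1 ≤ K) :
    ((K : ℝ)⁻¹ • clusterMatrix C) * ((K : ℝ)⁻¹ • clusterMatrix C)
      = (K : ℝ)⁻¹ • clusterMatrix C := by
  have : (K : ℝ) ≠ 0 := by positivity
  rw [Matrix.smul_mul, Matrix.mul_smul, clusterMatrix_mul_self hC, smul_smul, smul_smul]
  congr 1
  field_simp

/-- The first-order change of the trace norm along the improving direction. -/
lemma trace_mul_direction_le (hC : IsClustering K C) (hK : 1 ≤ K)
    (hA : ∀ i j, A i j = 0 ∨ A i j = 1) (ha : 0 ≤ a) (ht : 0 ≤ t)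
    {P : Matrix (Fin n) (Fin n) ℝ} (hP : P = (K : ℝ)⁻¹ • clusterMatrix C)
    {W : Matrix (Fin n) (Fin n) ℝ} (hW : IsContraction W) :
    (P * direction C A a t).trace
      + (((1 - P) * W * (1 - P)).transpose * direction C A a t).trace
      ≤ -(r * K) + a * (n - r * K) + t * √(n * ∑ i, ∑ j, offCluster C A i j) := by
  have hK0 : (K : ℝ) ≠ 0 := by positivity
  have hPt : P.transpose = P := by
    rw [hP, Matrix.transpose_smul, clusterMatrix_transpose]
  have hPP : P * P = P := by rw [hP]; exact smul_clusterMatrix_mul_self hC hK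
  have hY : clusterMatrix C = (K : ℝ) • P := by
    rw [hP, smul_smul, mul_inv_cancel₀ hK0, one_smul]
  have hQ := isContraction_one_sub hPt hPP
  set V := (1 - P) * W * (1 - P) with hV
  have hVc : IsContraction V := (hQ.mul hW).mul hQ
  have h1 : (P * direction C A a t).trace = -(r * K) := by
    rw [← hPt, trace_transpose_mul_eq_sum, hP]
    simp only [Matrix.smul_apply, smul_eq_mul, mul_assoc, ← Finset.mul_sum]
    rw [sum_clusterMatrix_mul_direction hC]
    field_simp
  -- `V` vanishes on the range of `P`
  have h2 : ∑ i, ∑ j, V i j * clusterMatrix C i j = 0 := by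
    have hQP : (1 - P) * P = 0 := by rw [Matrix.sub_mul, Matrix.one_mul, hPP, sub_self]
    rw [← trace_transpose_mul_eq_sum, hY, hV]
    simp only [Matrix.transpose_mul, Matrix.transpose_sub, Matrix.transpose_one, hPt,
      Matrix.mul_smul, Matrix.mul_assoc, hQP]
    simp
  -- `(1 - P) 1` is the indicator vector of the nodes outside all clusters
  have h3 : ∑ i, ∑ j, V i j ≤ n - r * K := by
    set e : Fin n → ℝ := fun _ => 1 with he
    set u := (1 - P).mulVec e with hu
    have hsum : ∀ M : Matrix (Fin n) (Fin n) ℝ, ∑ i, ∑ j, M i j = e ⬝ᵥ M.mulVec e := by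
      intro M
      simp [he, dotProduct, Matrix.mulVec]
    have hQt : (1 - P).transpose = 1 - P := by
      rw [Matrix.transpose_sub, Matrix.transpose_one, hPt]
    have hmove : ∀ z, e ⬝ᵥ (1 - P).mulVec z = u ⬝ᵥ z := by
      intro z
      rw [Matrix.dotProduct_mulVec, ← Matrix.mulVec_transpose, hQt]
    have hVu : e ⬝ᵥ V.mulVec e = u ⬝ᵥ W.mulVec u := by
      rw [hV, ← Matrix.mulVec_mulVec, ← Matrix.mulVec_mulVec, hmove]
    have huu : u ⬝ᵥ u = n - r * K := by
      have hQQ : (1 - P) * (1 - P) = 1 - P := by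
        rw [Matrix.mul_sub, Matrix.mul_one, Matrix.sub_mul, Matrix.one_mul, hPP]; simp
      rw [← hmove u, hu, Matrix.mulVec_mulVec, hQQ, Matrix.sub_mulVec, dotProduct_sub, ← hsum P,
        hP]
      simp only [Matrix.smul_apply, smul_eq_mul, ← Finset.mul_sum, sum_clusterMatrix hC]
      simp [he, dotProduct]
      field_simp
    rw [hsum, hVu, ← huu]
    exact hW.dotProduct_mulVec_le u
  have h4 : ∑ i, ∑ j, V i j * offCluster C A i j
      ≤ √(n * ∑ i, ∑ j, offCluster C A i j) := by
    rw [← trace_transpose_mul_eq_sum]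
    refine (trace_transpose_mul_le _ _).trans ?_
    have hf : frobSq (offCluster C A) = ∑ i, ∑ j, offCluster C A i j := by
      simp only [frobSq_eq_sum, offCluster_sq hA]
    rw [hf, Real.sqrt_mul (Nat.cast_nonneg n)]
    exact mul_le_mul_of_nonneg_right (Real.sqrt_le_sqrt hVc.frobSq_le) (Real.sqrt_nonneg _)
  rw [h1, trace_transpose_mul_eq_sum, sum_mul_direction, h2]
  have := mul_le_mul_of_nonneg_left h3 ha
  have := mul_le_mul_of_nonneg_left h4 ht
  linarith

/-- If the improving direction preserves the sum of the entries, decreases the trace norm to first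
order and increases the objective, then the cluster matrix is not optimal. -/
lemma not_isOptimalSolution_of_direction (hC : IsClustering K C) (hK : 1 ≤ K)
    (hA : ∀ i j, A i j = 0 ∨ A i j = 1) (ha : 0 ≤ a) (ht : 0 ≤ t)
    (hsum : a * ((n : ℝ) ^ 2 - r * K ^ 2) + t * ∑ i, ∑ j, offCluster C A i j = r * K ^ 2)
    (hnorm : a * (n - r * K) + t * √(n * ∑ i, ∑ j, offCluster C A i j) < r * K)
    (hobj : objective A (clusterMatrix C) < (a + t) * ∑ i, ∑ j, offCluster C A i j) :
    ¬ IsOptimalSolution r K A (clusterMatrix C) := by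
  rintro ⟨-, hopt⟩
  have hK0 : (0 : ℝ) < K := by positivity
  set H := direction C A a t with hH
  set P := (K : ℝ)⁻¹ • clusterMatrix C with hP
  set g := r * K - (a * (n - r * K) + t * √(n * ∑ i, ∑ j, offCluster C A i j)) with hg
  have hg0 : 0 < g := by linarith
  have hf0 := frobSq_nonneg H
  set ε := min 1 (min (1 / (a + t + 1)) (g * K / (2 * frobSq H + 1))) with hε
  have hε0 : 0 < ε := by
    refine lt_min one_pos (lt_min ?_ ?_) <;> positivity
  have hε1 : ε ≤ 1 := min_le_left _ _
  have hε2 : ε * (a + t + 1) ≤ 1 := by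
    rw [← le_div_iff₀ (by positivity)]
    exact (min_le_right _ _).trans (min_le_left _ _)
  have hε3 : ε * (2 * frobSq H + 1) ≤ g * K := by
    rw [← le_div_iff₀ (by positivity)]
    exact (min_le_right _ _).trans (min_le_right _ _)
  have hPt : P.transpose = P := by
    rw [hP, Matrix.transpose_smul, clusterMatrix_transpose]
  have hPP : P * P = P := smul_clusterMatrix_mul_self hC hK
  have hY : clusterMatrix C = (K : ℝ) • P := by
    rw [hP, smul_smul, mul_inv_cancel₀ hK0.ne', one_smul]
  have hfeas : clusterMatrix C + ε • H ∈ feasibleSet n r K := by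
    refine ⟨?_, ?_, ?_⟩
    · have h := traceNorm_smul_add_smul_le (H := H) hPt hPP hK0 hε0.le
        (fun W hW => trace_mul_direction_le hC hK hA ha ht hP hW)
      have htr : (K : ℝ) * P.trace = r * K := by
        rw [← smul_eq_mul (K : ℝ), ← Matrix.trace_smul, ← hY, trace_clusterMatrix hC]
      have h5 : 2 * ε ^ 2 * frobSq H / K ≤ ε * g := by
        rw [div_le_iff₀ hK0]
        have : ε * (ε * (2 * frobSq H)) ≤ ε * (g * K) :=
          mul_le_mul_of_nonneg_left (by linarith) hε0.le
        linarith
      rw [hY]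
      rw [htr] at h
      have h6 : ε * (-(r * K) + a * (n - r * K) + t * √(n * ∑ i, ∑ j, offCluster C A i j))
          = - (ε * g) := by rw [hg]; ring
      linarith
    · simp only [Matrix.add_apply, Matrix.smul_apply, smul_eq_mul, Finset.sum_add_distrib,
        ← Finset.mul_sum]
      rw [sum_clusterMatrix hC, hH, sum_direction hC]
      linear_combination ε * hsum
    · intro i j
      have hat : 0 ≤ ε * a := by positivity
      have htt : 0 ≤ ε * t := by positivity
      simp only [Matrix.add_apply, Matrix.smul_apply, smul_eq_mul, hH, direction, offCluster,
        Matrix.of_apply]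
      rcases clusterMatrix_eq_zero_or_one C i j with h | h <;> rcases hA i j with h' | h' <;>
        rw [h, h'] <;> constructor <;> nlinarith
  have h := hopt _ hfeas
  have hlin : objective A (clusterMatrix C + ε • H)
      = objective A (clusterMatrix C) + ε * objective A H := by
    simp only [objective, Matrix.add_apply, Matrix.smul_apply, smul_eq_mul, Finset.mul_sum,
      ← Finset.sum_add_distrib]
    refine Finset.sum_congr rfl fun i _ => Finset.sum_congr rfl fun j _ => ?_
    ring
  rw [hlin, hH, objective_direction hA] at h
  have : 0 < ε * ((a + t) * (∑ i, ∑ j, offCluster C A i j) - objective A (clusterMatrix C)) :=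
    mul_pos hε0 (by linarith)
  linarith

end

/-! ### Tails of sums of independent indicators -/

section

variable {Ω ι : Type*} [MeasurableSpace Ω] {μ : Measure Ω} [IsProbabilityMeasure μ]

lemma mgf_indicator_le {s : Set Ω} (hs : MeasurableSet s) {θ : ℝ} (hθ : |θ| ≤ 1) :
    mgf (s.indicator fun _ => (1 : ℝ)) μ θ ≤ Real.exp (μ.real s * (θ + θ ^ 2)) := by
  have h1 : (fun ω => Real.exp (θ * s.indicator (fun _ => (1 : ℝ)) ω))
      = fun ω => 1 + s.indicator (fun _ => Real.exp θ - 1) ω := by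
    funext ω
    by_cases h : ω ∈ s <;> simp [h]
  have h2 : mgf (s.indicator fun _ => (1 : ℝ)) μ θ = 1 + μ.real s * (Real.exp θ - 1) := by
    rw [mgf, h1, integral_add (integrable_const _) ((integrable_const _).indicator hs),
      integral_indicator_const _ hs]
    simp
  have h3 : Real.exp θ - 1 ≤ θ + θ ^ 2 := by
    have := (abs_le.mp (Real.abs_exp_sub_one_sub_id_le hθ)).2
    linarith
  rw [h2]
  have h4 := mul_le_mul_of_nonneg_left h3 (measureReal_nonneg (μ := μ) (s := s))
  have h5 := Real.add_one_le_exp (μ.real s * (θ + θ ^ 2))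
  linarith

lemma mgf_sum_indicator_le {s : ι → Set Ω} (hs : ∀ i, MeasurableSet (s i)) (hind : iIndepSet s μ)
    (T : Finset ι) {θ : ℝ} (hθ : |θ| ≤ 1) :
    mgf (∑ i ∈ T, (s i).indicator fun _ => (1 : ℝ)) μ θ
      ≤ Real.exp ((∑ i ∈ T, μ.real (s i)) * (θ + θ ^ 2)) := by
  have h := hind.iIndepFun_indicator (β := ℝ) (m := inferInstance)
  rw [h.mgf_sum (fun i => measurable_const.indicator (hs i)), Finset.sum_mul, Real.exp_sum]
  exact Finset.prod_le_prod (fun i _ => mgf_nonneg) fun i _ => mgf_indicator_le (hs i) hθ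

lemma integrable_exp_sum_indicator {s : ι → Set Ω} (hs : ∀ i, MeasurableSet (s i))
    (T : Finset ι) (θ : ℝ) :
    Integrable (fun ω => Real.exp (θ * (∑ i ∈ T, (s i).indicator fun _ => (1 : ℝ)) ω)) μ := by
  have hm : Measurable (∑ i ∈ T, (s i).indicator fun _ => (1 : ℝ)) := by
    rw [show (∑ i ∈ T, (s i).indicator fun _ => (1 : ℝ))
      = fun ω => ∑ i ∈ T, (s i).indicator (fun _ => (1 : ℝ)) ω from
        funext fun ω => Finset.sum_apply _ _ _]
    exact Finset.measurable_sum _ fun i _ => measurable_const.indicator (hs i)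
  refine Integrable.of_bound (C := Real.exp (|θ| * T.card)) (by fun_prop) ?_
  refine Filter.Eventually.of_forall fun ω => ?_
  rw [Real.norm_eq_abs, abs_of_pos (Real.exp_pos _), Real.exp_le_exp, Finset.sum_apply]
  refine (le_abs_self _).trans ?_
  rw [abs_mul]
  refine mul_le_mul_of_nonneg_left ?_ (abs_nonneg θ)
  refine (Finset.abs_sum_le_sum_abs _ _).trans ?_
  have : ∀ i ∈ T, |(s i).indicator (fun _ => (1 : ℝ)) ω| ≤ 1 := by
    intro i _
    by_cases h : ω ∈ s i <;> simp [h]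
  simpa using Finset.sum_le_sum this

/-- Chernoff bound for the upper tail, with a free parameter `θ`. -/
lemma measureReal_sum_indicator_ge_le {s : ι → Set Ω} (hs : ∀ i, MeasurableSet (s i))
    (hind : iIndepSet s μ) (T : Finset ι) {m θ : ℝ} (hm : ∑ i ∈ T, μ.real (s i) = m)
    (hθ : 0 < θ) (hθ1 : θ ≤ 1) (L : ℝ) :
    μ.real {ω | m * (1 + θ) + L / θ ≤ (∑ i ∈ T, (s i).indicator fun _ => (1 : ℝ)) ω}
      ≤ Real.exp (-L) := by
  have h1 := measure_ge_le_exp_mul_mgf (μ := μ) (m * (1 + θ) + L / θ) hθ.le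
    (integrable_exp_sum_indicator hs T θ)
  have h2 := mgf_sum_indicator_le hs hind T (θ := θ) (by rwa [abs_of_pos hθ])
  refine h1.trans ((mul_le_mul_of_nonneg_left h2 (Real.exp_pos _).le).trans_eq ?_)
  rw [← Real.exp_add, hm]
  congr 1
  field_simp
  ring

/-- Chernoff bound for the lower tail, with a free parameter `θ`. -/
lemma measureReal_sum_indicator_le_le {s : ι → Set Ω} (hs : ∀ i, MeasurableSet (s i))
    (hind : iIndepSet s μ) (T : Finset ι) {m θ : ℝ} (hm : ∑ i ∈ T, μ.real (s i) = m)
    (hθ : 0 < θ) (hθ1 : θ ≤ 1) (L : ℝ) :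
    μ.real {ω | (∑ i ∈ T, (s i).indicator fun _ => (1 : ℝ)) ω ≤ m * (1 - θ) - L / θ}
      ≤ Real.exp (-L) := by
  have h1 := measure_le_le_exp_mul_mgf (μ := μ) (m * (1 - θ) - L / θ)
    (neg_nonpos.mpr hθ.le) (integrable_exp_sum_indicator hs T (-θ))
  have h2 := mgf_sum_indicator_le hs hind T (θ := -θ) (by rwa [abs_neg, abs_of_pos hθ])
  refine h1.trans ((mul_le_mul_of_nonneg_left h2 (Real.exp_pos _).le).trans_eq ?_)
  rw [← Real.exp_add, hm]
  congr 1
  field_simp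
  ring

end

/-! ### Edge counts of the planted graph -/

lemma sum_sum_eq_two_mul_sum_lt {n : ℕ} (f : Fin n → Fin n → ℝ) (hf : ∀ i j, f i j = f j i) :
    ∑ i, ∑ j, f i j
      = 2 * (∑ e : {e : Fin n × Fin n // e.1 < e.2}, f e.1.1 e.1.2) + ∑ i, f i i := by
  have h1 : ∑ e : {e : Fin n × Fin n // e.1 < e.2}, f e.1.1 e.1.2
      = ∑ i, ∑ j, if i < j then f i j else 0 := by
    rw [← Finset.sum_product', Finset.univ_product_univ, ← Finset.sum_filter]
    symm
    exact Finset.sum_subtype _ (by simp) (fun e : Fin n × Fin n => f e.1 e.2)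
  have h2 : ∑ i, ∑ j, (if j < i then f i j else 0) = ∑ i, ∑ j, if i < j then f i j else 0 := by
    rw [Finset.sum_comm]
    refine Finset.sum_congr rfl fun i _ => Finset.sum_congr rfl fun j _ => ?_
    rw [hf]
  have h3 : ∑ i, f i i = ∑ i, ∑ j, if i = j then f i j else 0 := by simp
  rw [two_mul, h1, h3]
  nth_rewrite 2 [← h2]
  simp only [← Finset.sum_add_distrib]
  refine Finset.sum_congr rfl fun i _ => Finset.sum_congr rfl fun j _ => ?_
  rcases lt_trichotomy i j with h | h | h
  · simp [h, h.ne, h.not_gt]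
  · simp [h]
  · simp [h, h.ne', h.not_gt]

lemma adjacency_eq_zero_or_one {n : ℕ} (G : SimpleGraph (Fin n)) (i j : Fin n) :
    adjacency G i j = 0 ∨ adjacency G i j = 1 := by
  classical
  by_cases h : G.Adj i j <;> simp [adjacency, h]

lemma clusterMatrix_comm {n r : ℕ} (C : Fin r → Finset (Fin n)) (i j : Fin n) :
    clusterMatrix C i j = clusterMatrix C j i := by
  conv_lhs => rw [← clusterMatrix_transpose C, Matrix.transpose_apply]

lemma adjacency_comm {n : ℕ} (G : SimpleGraph (Fin n)) (i j : Fin n) :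
    adjacency G i j = adjacency G j i := by
  classical
  simp [adjacency, G.adj_comm]

lemma adjacency_self {n : ℕ} (G : SimpleGraph (Fin n)) (i : Fin n) : adjacency G i i = 0 := by
  classical
  simp [adjacency]

section

variable {Ω : Type*} {n r K : ℕ} {C : Fin r → Finset (Fin n)} {p q : ℝ}
  {G : Ω → SimpleGraph (Fin n)}

lemma adjacency_eq_indicator (i j : Fin n) (ω : Ω) :
    adjacency (G ω) i j = {ω | (G ω).Adj i j}.indicator (fun _ => (1 : ℝ)) ω := by
  classical
  by_cases h : (G ω).Adj i j <;> simp [adjacency, h]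

open Classical in
/-- The unordered pairs (encoded as increasing ordered pairs) of distinct nodes in a common
cluster. -/
noncomputable def clusterPairs (C : Fin r → Finset (Fin n)) :
    Finset {e : Fin n × Fin n // e.1 < e.2} :=
  Finset.univ.filter fun e => SameCluster C e.1.1 e.1.2

lemma sum_clusterPairs (C : Fin r → Finset (Fin n))
    (f : {e : Fin n × Fin n // e.1 < e.2} → ℝ) :
    ∑ e ∈ clusterPairs C, f e = ∑ e, f e * clusterMatrix C e.1.1 e.1.2 := by
  classical
  rw [clusterPairs, Finset.sum_filter]
  refine Finset.sum_congr rfl fun e _ => ?_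
  by_cases h : SameCluster C e.1.1 e.1.2
  · simp [h, clusterMatrix_of_sameCluster h]
  · simp [h, clusterMatrix_of_not_sameCluster h]

lemma sum_clusterPairs_compl (C : Fin r → Finset (Fin n))
    (f : {e : Fin n × Fin n // e.1 < e.2} → ℝ) :
    ∑ e ∈ (clusterPairs C)ᶜ, f e = ∑ e, f e * (1 - clusterMatrix C e.1.1 e.1.2) := by
  have h1 := Finset.sum_add_sum_compl (clusterPairs C) f
  have h2 := sum_clusterPairs C f
  simp only [mul_sub, mul_one, Finset.sum_sub_distrib]
  linarith

lemma two_mul_card_clusterPairs (hC : IsClustering K C) :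
    2 * ((clusterPairs C).card : ℝ) = r * K ^ 2 - r * K := by
  have h1 := sum_sum_eq_two_mul_sum_lt (fun i j => clusterMatrix C i j) (clusterMatrix_comm C)
  have h2 := sum_clusterPairs C (fun _ => 1)
  have h3 := trace_clusterMatrix hC
  simp only [Matrix.trace, Matrix.diag] at h3
  rw [sum_clusterMatrix hC, h3] at h1
  simp only [one_mul, Finset.sum_const, nsmul_eq_mul, mul_one] at h2
  rw [h2]
  linarith

lemma two_mul_card_clusterPairs_compl (hC : IsClustering K C) :
    2 * ((clusterPairs C)ᶜ.card : ℝ) = ((n : ℝ) ^ 2 - r * K ^ 2) - (n - r * K) := by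
  have h1 := sum_sum_eq_two_mul_sum_lt (n := n) (fun _ _ => 1) (fun _ _ => rfl)
  have h2 := Finset.sum_add_sum_compl (clusterPairs C) (fun _ => (1 : ℝ))
  have h3 := two_mul_card_clusterPairs hC
  rw [← h2] at h1
  simp only [Finset.sum_const, nsmul_eq_mul, mul_one, Finset.card_univ, Fintype.card_fin] at h1
  linarith

lemma objective_clusterMatrix_eq (ω : Ω) :
    objective (adjacency (G ω)) (clusterMatrix C) = 2 * (∑ e ∈ clusterPairs C,
      {ω | (G ω).Adj e.1.1 e.1.2}.indicator fun _ => (1 : ℝ)) ω := by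
  rw [objective, sum_sum_eq_two_mul_sum_lt (fun i j => adjacency (G ω) i j * clusterMatrix C i j)
    (fun i j => by rw [adjacency_comm, clusterMatrix_comm]), Finset.sum_apply, sum_clusterPairs]
  simp [adjacency_self, adjacency_eq_indicator]

lemma sum_offCluster_eq (ω : Ω) :
    ∑ i, ∑ j, offCluster C (adjacency (G ω)) i j = 2 * (∑ e ∈ (clusterPairs C)ᶜ,
      {ω | (G ω).Adj e.1.1 e.1.2}.indicator fun _ => (1 : ℝ)) ω := by
  rw [sum_sum_eq_two_mul_sum_lt (fun i j => offCluster C _ i j)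
    (fun i j => by simp only [offCluster, Matrix.of_apply]
                   rw [adjacency_comm, clusterMatrix_comm]), Finset.sum_apply,
    sum_clusterPairs_compl]
  simp [offCluster, adjacency_eq_indicator]

variable [MeasurableSpace Ω] {μ : Measure Ω}

lemma IsPlantedGraph.sum_prob_clusterPairs (hG : IsPlantedGraph μ C p q G) :
    ∑ e ∈ clusterPairs C, μ.real {ω | (G ω).Adj e.1.1 e.1.2} = p * (clusterPairs C).card := by
  classical
  rw [Finset.sum_congr rfl (g := fun _ => p)]
  · simp [mul_comm]
  · intro e he
    have : SameCluster C e.1.1 e.1.2 := by simpa [clusterPairs] using he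
    rw [hG.prob_adj _ _ e.2, if_pos this]

lemma IsPlantedGraph.sum_prob_clusterPairs_compl (hG : IsPlantedGraph μ C p q G) :
    ∑ e ∈ (clusterPairs C)ᶜ, μ.real {ω | (G ω).Adj e.1.1 e.1.2}
      = q * (clusterPairs C)ᶜ.card := by
  classical
  rw [Finset.sum_congr rfl (g := fun _ => q)]
  · simp [mul_comm]
  · intro e he
    have : ¬ SameCluster C e.1.1 e.1.2 := by simpa [clusterPairs] using he
    rw [hG.prob_adj _ _ e.2, if_neg this]

variable [IsProbabilityMeasure μ]

lemma IsPlantedGraph.measureReal_objective_gt_le (hG : IsPlantedGraph μ C p q G)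
    (hC : IsClustering K C) (hp : 0 ≤ p) {θ : ℝ} (hθ : 0 < θ) (hθ1 : θ ≤ 1) (L : ℝ) :
    μ.real {ω | p * (r * K ^ 2) * (1 + θ) + 2 * L / θ
      < objective (adjacency (G ω)) (clusterMatrix C)} ≤ Real.exp (-L) := by
  refine (measureReal_mono ?_).trans (measureReal_sum_indicator_ge_le
    (fun e => hG.measurableSet_adj _ _) hG.indep (clusterPairs C)
    hG.sum_prob_clusterPairs hθ hθ1 L)
  intro ω hω
  simp only [Set.mem_ofPred_eq] at hω ⊢
  rw [objective_clusterMatrix_eq] at hω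
  have h1 := two_mul_card_clusterPairs hC
  have h2 : p * ((clusterPairs C).card : ℝ) * (1 + θ) ≤ p * (r * K ^ 2 / 2) * (1 + θ) := by
    have : (0 : ℝ) ≤ r * K := by positivity
    gcongr
    linarith
  have h3 : 2 * L / θ = 2 * (L / θ) := by ring
  rw [h3] at hω
  linarith

lemma IsPlantedGraph.measureReal_sum_offCluster_lt_le (hG : IsPlantedGraph μ C p q G)
    (hC : IsClustering K C) {θ : ℝ} (hθ : 0 < θ) (hθ1 : θ ≤ 1) (L : ℝ) :
    μ.real {ω | ∑ i, ∑ j, offCluster C (adjacency (G ω)) i j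
      < q * (((n : ℝ) ^ 2 - r * K ^ 2) - (n - r * K)) * (1 - θ) - 2 * L / θ}
      ≤ Real.exp (-L) := by
  refine (measureReal_mono ?_).trans (measureReal_sum_indicator_le_le
    (fun e => hG.measurableSet_adj _ _) hG.indep (clusterPairs C)ᶜ
    hG.sum_prob_clusterPairs_compl hθ hθ1 L)
  intro ω hω
  simp only [Set.mem_ofPred_eq] at hω ⊢
  rw [sum_offCluster_eq, ← two_mul_card_clusterPairs_compl hC] at hω
  have h3 : 2 * L / θ = 2 * (L / θ) := by ring
  rw [h3] at hω
  linarith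

end

/-! ### Choice of the improving direction -/

/-- Rates `a`, `t` of an improving direction. Here `R = rK` is the number of clustered nodes, `N`
the number of edges off the clusters, `S` that inside the clusters (both counting ordered pairs),
and `v = √(N / n)`. -/
lemma exists_rates {n K R N S v : ℝ} (hK : 0 < K) (hR : 0 < R) (hRn : R ≤ n) (hKn : 2 * K ≤ n)
    (hv : 0 < v) (hN : N = n * v ^ 2) (hS : S < R * K)
    (h : v < 4 * K → N / (n ^ 2 - R * K) < S / (R * K) →
      S - R * K * (N / (n ^ 2 - R * K)) < R * v / 4 * (1 - N / (n ^ 2 - R * K))) :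
    ∃ a t : ℝ, 0 ≤ a ∧ 0 ≤ t ∧ a * (n ^ 2 - R * K) + t * N = R * K ∧
      a * (n - R) + t * √(n * N) < R ∧ S < (a + t) * N := by
  have hn : 0 < n := by linarith
  have hRK : 0 < R * K := mul_pos hR hK
  have hRKn : R * K ≤ n * K := mul_le_mul_of_nonneg_right hRn hK.le
  have hM : 0 < n ^ 2 - R * K := by nlinarith
  set M := n ^ 2 - R * K with hMdef
  have hN0 : 0 < N := by rw [hN]; positivity
  -- `x` is the weight moved onto the edges off the clusters
  set x := min (R * K) (R * v / 4) with hx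
  have hx0 : 0 < x := lt_min hRK (by positivity)
  have hx1 : x ≤ R * K := min_le_left _ _
  have hx2 : x ≤ R * v / 4 := min_le_right _ _
  refine ⟨(R * K - x) / M, x / N, div_nonneg (by linarith) hM.le, by positivity, ?_, ?_, ?_⟩
  · field_simp
    ring
  · have hsq : √(n * N) = n * v := by
      rw [hN, show n * (n * v ^ 2) = (n * v) ^ 2 by ring, Real.sqrt_sq (by positivity)]
    have h1 : x / N * √(n * N) ≤ R / 4 := by
      rw [hsq, hN, show x / (n * v ^ 2) * (n * v) = x / v by field_simp, div_le_iff₀ hv]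
      linarith
    have h2 : (R * K - x) / M * (n - R) ≤ R / 2 := by
      have h3 : (R * K - x) / M * (n - R) ≤ R * K / M * (n - R) := by
        have : 0 ≤ n - R := by linarith
        gcongr
        linarith
      refine h3.trans ?_
      rw [div_mul_eq_mul_div, div_le_iff₀ hM]
      have h4 : K * (n - R) ≤ M / 2 := by nlinarith
      have := mul_le_mul_of_nonneg_left h4 hR.le
      linarith
    linarith
  · set w := N / M with hw
    have hobj : ((R * K - x) / M + x / N) * N = (R * K - x) * w + x := by
      rw [hw]; field_simp
    have hw0 : 0 < w := div_pos hN0 hM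
    rw [hobj]
    rcases le_or_gt (4 * K) v with hc | hc
    · have : x = R * K := min_eq_left (by nlinarith)
      rw [this]; linarith
    · -- if the graph is at least as dense off the clusters, any weight `x > 0` will do
      rcases le_or_gt (S / (R * K)) w with hd | hd
      · have h1 : S = R * K * (S / (R * K)) := by field_simp
        have h2 : S / (R * K) < 1 := by rwa [div_lt_one hRK]
        have h3 := mul_le_mul_of_nonneg_left hd (sub_nonneg.mpr hx1)
        have h4 := mul_pos hx0 (sub_pos.mpr h2)
        nlinarith
      · have h1 := h hc hd
        have : x = R * v / 4 := min_eq_right (by nlinarith)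
        rw [this]; linarith

/-- Below the threshold the noise level `y = √(qn)` dominates the signal `K (p - q)`. -/
lemma gap_le_of_sq_le {K n p q y γ : ℝ} (hγ : 0 < γ) (hγ1 : γ ≤ 1) (hy : 1 ≤ y)
    (hy2 : y ^ 2 = q * n) (hq : 0 ≤ q) (hKn : 2 * K ≤ n)
    (h : K ^ 2 * (p - q) ^ 2 ≤ γ ^ 2 / 4 * (K * p + q * n)) :
    K * (p - q) ≤ γ * y ∧ K * p ≤ 3 / 2 * y ^ 2 := by
  have hKq : K * q ≤ y ^ 2 / 2 := by
    have := mul_le_mul_of_nonneg_right hKn hq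
    rw [hy2]; linarith
  have hx : K * (p - q) ≤ γ * y := by
    by_contra hcon
    push Not at hcon
    set x := K * (p - q) with hxdef
    have h1 : x ^ 2 ≤ γ ^ 2 / 4 * (x + 3 / 2 * y ^ 2) := by
      have e1 : K ^ 2 * (p - q) ^ 2 = x ^ 2 := by rw [hxdef]; ring
      have e2 : K * p + q * n ≤ x + 3 / 2 * y ^ 2 := by rw [hxdef, ← hy2]; linarith
      rw [e1] at h
      exact h.trans (mul_le_mul_of_nonneg_left e2 (by positivity))
    have hγy : 0 < γ * y := by positivity
    have h2 : (γ * y) ^ 2 ≤ x ^ 2 := by gcongr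
    have h3 : γ ^ 2 * x ≤ x ^ 2 := by
      have : γ * γ ≤ γ * y := mul_le_mul_of_nonneg_left (by linarith) hγ.le
      nlinarith
    nlinarith
  refine ⟨hx, ?_⟩
  have : γ * y ≤ y ^ 2 := by nlinarith
  linarith

/-- The edge counts inside and off the clusters satisfy the condition of `exists_rates`, provided
that they obey tail bounds with parameter `θ = ε / (200 y)` and additive error `D`. -/
lemma edge_density_estimates {n K R N S D θ p q y ε : ℝ} (hε : 0 < ε) (hε1 : ε < 1) (hK : 0 < K)
    (hKR : K ≤ R) (hRn : R ≤ n) (hKn : 2 * K ≤ n) (hn : 8 ≤ n) (hq : 0 < q) (hq1 : q ≤ 1)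
    (hy : 830 ≤ ε * y) (hy2 : y ^ 2 = q * n) (hp : p ≤ 1 - ε)
    (hgap : K * (p - q) ≤ ε / 64 * y) (hKp : K * p ≤ 3 / 2 * y ^ 2) (hθ : θ = ε / 200 / y)
    (hDK : D ≤ 44 / 10000 * (ε * K * y)) (hDn : D ≤ 22 / 10000 * (ε * n * y))
    (hS : S ≤ p * (R * K) * (1 + θ) + D)
    (hN : q * ((n ^ 2 - R * K) - (n - R)) * (1 - θ) - D ≤ N) :
    0 < N ∧ ∀ v, 0 < v → N = n * v ^ 2 →
      v < 4 * K → N / (n ^ 2 - R * K) < S / (R * K) →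
      S - R * K * (N / (n ^ 2 - R * K)) < R * v / 4 * (1 - N / (n ^ 2 - R * K)) := by
  have hR : 0 < R := by linarith
  have hn0 : 0 < n := by linarith
  have hy0 : 0 < y := pos_of_mul_pos_right (by linarith) hε.le
  have hy830 : 830 ≤ y := hy.trans (mul_le_of_le_one_left hy0.le hε1.le)
  have hθy : θ * y = ε / 200 := by rw [hθ]; field_simp
  have hθ0 : 0 < θ := by rw [hθ]; positivity
  have hθ1 : θ ≤ 1 / 8 := by rw [hθ, div_le_iff₀ hy0]; linarith
  have hRKn : R * K ≤ n * K := mul_le_mul_of_nonneg_right hRn hK.le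
  have hKn' := mul_le_mul_of_nonneg_left hKn hn0.le
  have hKnR := mul_le_mul_of_nonneg_right (show K ≤ n by linarith) hR.le
  have hM2 : n ^ 2 / 2 ≤ n ^ 2 - R * K := by linarith
  have hMn : n * (n - R) ≤ n ^ 2 - R * K := by linarith
  set M := n ^ 2 - R * K with hMdef
  have hM : 0 < M := lt_of_lt_of_le (by positivity) hM2
  have hnR : 0 ≤ n - R := by linarith
  have hN1 : q * M * (1 - θ) - q * (n - R) - D ≤ N := by
    have : 0 ≤ q * (n - R) * θ := by positivity
    linarith
  have hqM : y ^ 2 * n / 2 ≤ q * M := by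
    rw [hy2]
    have := mul_le_mul_of_nonneg_left hM2 hq.le
    linarith
  have hqM0 : 0 ≤ q * M := by positivity
  have hNM : q * M / 2 ≤ N := by
    have h1 : q * M * θ ≤ q * M / 8 := by
      have := mul_le_mul_of_nonneg_left hθ1 (by positivity : 0 ≤ q * M)
      linarith
    have h2 : q * (n - R) ≤ q * M / 8 := by
      have h2 := mul_le_mul_of_nonneg_right hn hnR
      have : n - R ≤ M / 8 := by linarith
      have := mul_le_mul_of_nonneg_left this hq.le
      linarith
    have h3 : D ≤ q * M / 8 := by
      have h4 : ε * n * y ≤ y ^ 2 * n := by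
        have h5 : ε * (n * y) ≤ y * (n * y) :=
          mul_le_mul_of_nonneg_right (by linarith) (by positivity)
        linarith
      linarith
    linarith
  have hN0 : 0 < N := lt_of_lt_of_le (by positivity) hNM
  refine ⟨hN0, fun v hv hNv hvK hlt => ?_⟩
  have hvy : y / 2 ≤ v := by
    have h1 : n * (y ^ 2 / 4) ≤ n * v ^ 2 := by rw [← hNv]; linarith
    have h2 : (y / 2) ^ 2 ≤ v ^ 2 := by
      have := le_of_mul_le_mul_left h1 hn0
      linarith
    exact le_of_sq_le_sq h2 hv.le
  set w := N / M with hw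
  set z := S / (R * K) with hz
  have hSz : S = R * (K * z) := by rw [hz]; field_simp
  have hyK : y < 8 * K := by linarith
  have hKz : K * z ≤ K * p + ε / 64 * y := by
    have h1 : R * (K * z) ≤ R * (K * p + K * p * θ + 44 / 10000 * (ε * y)) := by
      have h2 : ε * K * y ≤ ε * R * y := by gcongr
      rw [← hSz]
      linarith
    have h3 := le_of_mul_le_mul_left h1 hR
    have h4 : K * p * θ ≤ 3 / 2 * (ε / 200) * y := by
      have := mul_le_mul_of_nonneg_right hKp hθ0.le
      have e : 3 / 2 * y ^ 2 * θ = 3 / 2 * (ε / 200) * y := by rw [← hθy]; ring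
      linarith
    have : 0 < ε * y := by positivity
    linarith
  have hz1 : z ≤ 1 - 7 / 8 * ε := by
    have h1 : K * z ≤ K * (p + ε / 8) := by
        have := mul_le_mul_of_nonneg_left hyK.le hε.le
        linarith
    have h2 := le_of_mul_le_mul_left h1 hK
    linarith
  have hKw : K * q - ε / 64 * y ≤ K * w := by
    have h1 : K * (q * M * (1 - θ) - q * (n - R) - D) ≤ K * w * M := by
      have : K * w * M = K * N := by rw [hw]; field_simp
      rw [this]
      exact mul_le_mul_of_nonneg_left hN1 hK.le
    have hKqn : K * q ≤ y ^ 2 / 2 := by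
      rw [hy2]
      have := mul_le_mul_of_nonneg_right hKn hq.le
      linarith
    have h2 : K * q * θ ≤ ε / 400 * y := by
      have := mul_le_mul_of_nonneg_right hKqn hθ0.le
      have e : y ^ 2 / 2 * θ = ε / 400 * y := by
        rw [show ε / 400 = ε / 200 / 2 by ring, ← hθy]; ring
      linarith
    have h3 : K * (q * (n - R)) ≤ 1 / 2 * M := by
      have h4 : K * (q * (n - R)) ≤ K * (1 * (n - R)) := by gcongr
      have h5 : 2 * K * (n - R) ≤ n * (n - R) := mul_le_mul_of_nonneg_right hKn hnR
      linarith
    have h6 : K * D ≤ 22 / 10000 * (ε * y) * M := by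
      have h7 : K * D ≤ n / 2 * (22 / 10000 * (ε * n * y)) := by
        have : 0 ≤ 22 / 10000 * (ε * n * y) := by positivity
        exact (mul_le_mul_of_nonneg_left hDn hK.le).trans
          (mul_le_mul_of_nonneg_right (by linarith) this)
      have h8 := mul_le_mul_of_nonneg_left hM2 (by positivity : 0 ≤ 22 / 10000 * (ε * y))
      linarith
    have h9 := mul_le_mul_of_nonneg_right h2 hM.le
    have h10 : (K * q - ε / 400 * y - 1 / 2 - 22 / 10000 * (ε * y)) * M ≤ K * w * M := by
      linarith
    have h11 := le_of_mul_le_mul_right h10 hM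
    linarith
  have hw1 : 7 / 8 * ε ≤ 1 - w := by linarith
  have h1 : K * z - K * w ≤ 3 * (ε / 64 * y) := by linarith
  have h2 : y / 8 * (7 / 8 * ε) ≤ v / 4 * (1 - w) := by
    have : y / 8 ≤ v / 4 := by linarith
    gcongr
  have h3 : K * z - K * w < v / 4 * (1 - w) := by
    have : 0 < ε * y := by positivity
    linarith
  have h4 := mul_lt_mul_of_pos_left h3 hR
  rw [hSz]
  linarith

end PlantedClustering

theorem theorem4 (ε₀ : ℝ) (hε₀ : 0 < ε₀) (hε₀' : ε₀ < 1) :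
    ∃ c₁ c₂ : ℝ, 0 < c₁ ∧ 0 < c₂ ∧
      ∀ (n r K : ℕ) (p q : ℝ) (C : Fin r → Finset (Fin n)),
        1 ≤ r → 1 ≤ K → PlantedClustering.IsClustering K C →
        0 ≤ q → q < p → p ≤ 1 →
        c₁ * Real.log n ≤ K → (K : ℝ) ≤ n / 2 →
        c₁ * (Real.log n / n) ≤ q →
        p ≤ 1 - ε₀ →
        (K : ℝ) ^ 2 * (p - q) ^ 2 ≤ c₂ * (K * p + q * n) →
        ∀ {Ω : Type*} [MeasurableSpace Ω] (μ : Measure Ω) [IsProbabilityMeasure μ]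
          (G : Ω → SimpleGraph (Fin n)),
          PlantedClustering.IsPlantedGraph μ C p q G →
          1 - 1 / (n : ℝ) ^ 10 ≤
            μ.real {ω | ¬ PlantedClustering.IsOptimalSolution r K
              (PlantedClustering.adjacency (G ω)) (PlantedClustering.clusterMatrix C)} := by
  refine ⟨10 ^ 6 / ε₀ ^ 2, (ε₀ / 64) ^ 2 / 4, by positivity, by positivity, ?_⟩
  intro n r K p q C hr hK hC hq0 hqp hp1 hKlog hKn hqlog hpε hsig Ω _ μ _ G hG
  have hK1 : (1 : ℝ) ≤ K := by exact_mod_cast hK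
  have hr1 : (1 : ℝ) ≤ r := by exact_mod_cast hr
  have hn2 : (2 : ℝ) ≤ n := by linarith
  have hn0 : (0 : ℝ) < n := by linarith
  have hlog : 69 / 100 ≤ Real.log n := by
    have h1 := Real.log_two_gt_d9
    have h2 := Real.log_le_log (by norm_num) hn2
    linarith
  have hlogK : Real.log n ≤ ε₀ ^ 2 * K / 10 ^ 6 := by
    rw [div_mul_eq_mul_div, div_le_iff₀ (by positivity)] at hKlog
    rw [le_div_iff₀ (by norm_num)]
    linarith
  have hqn : 10 ^ 6 / ε₀ ^ 2 * Real.log n ≤ q * n := by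
    rw [← mul_div_assoc, div_le_iff₀ hn0] at hqlog
    exact hqlog
  have hKbig : 690000 ≤ (K : ℝ) := by
    have : ε₀ ^ 2 ≤ 1 := by nlinarith
    have : ε₀ ^ 2 * K ≤ 1 * K := by gcongr
    rw [le_div_iff₀ (by norm_num)] at hlogK
    linarith
  set y := √(q * n) with hy
  have hy2 : y ^ 2 = q * n := Real.sq_sqrt (by positivity)
  have hεy : 830 ≤ ε₀ * y := by
    have h1 : (830 : ℝ) ^ 2 ≤ (ε₀ * y) ^ 2 := by
      rw [mul_pow, hy2]
      rw [div_mul_eq_mul_div, div_le_iff₀ (by positivity)] at hqn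
      linarith
    exact le_of_sq_le_sq h1 (by positivity)
  have hy0 : 0 < y := pos_of_mul_pos_right (by linarith) hε₀.le
  have hy1 : 830 ≤ y := hεy.trans (mul_le_of_le_one_left hy0.le hε₀'.le)
  have hq : 0 < q := by
    rcases hq0.eq_or_lt with h | h
    · rw [← h, zero_mul] at hy2
      exact absurd hy2 (by positivity)
    · exact h
  obtain ⟨hgap, hKp⟩ := PlantedClustering.gap_le_of_sq_le (K := (K : ℝ)) (γ := ε₀ / 64)
    (by positivity) (by linarith) (by linarith) hy2 hq0 (by linarith) hsig
  have hrKn := hC.mul_le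
  have hKrK : (K : ℝ) ≤ r * K := le_mul_of_one_le_left (by linarith) hr1
  -- `θ` is of order `1 / y`, so that `K p θ` and `L / (θ K)` are both small multiples of `y`
  set θ := ε₀ / 200 / y with hθ
  have hθ0 : 0 < θ := by positivity
  have hθ1 : θ ≤ 1 := by rw [hθ, div_le_one hy0]; linarith
  set L := 11 * Real.log n with hL
  set U := {ω | p * (r * K ^ 2) * (1 + θ) + 2 * L / θ
    < PlantedClustering.objective (PlantedClustering.adjacency (G ω))
      (PlantedClustering.clusterMatrix C)} with hU
  set V := {ω | ∑ i, ∑ j, PlantedClustering.offCluster C (PlantedClustering.adjacency (G ω)) i j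
    < q * (((n : ℝ) ^ 2 - r * K ^ 2) - (n - r * K)) * (1 - θ) - 2 * L / θ} with hV
  have hPU : μ.real U ≤ Real.exp (-L) :=
    hG.measureReal_objective_gt_le hC (by linarith) hθ0 hθ1 L
  have hPV : μ.real V ≤ Real.exp (-L) :=
    hG.measureReal_sum_offCluster_lt_le hC hθ0 hθ1 L
  have hexp : 2 * Real.exp (-L) ≤ 1 / (n : ℝ) ^ 10 := by
    have e : Real.exp (-L) = 1 / (n : ℝ) ^ 11 := by
      rw [Real.exp_neg, hL, show (11 : ℝ) * Real.log n = ((11 : ℕ) : ℝ) * Real.log n by norm_num,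
        Real.exp_nat_mul, Real.exp_log hn0, one_div]
    rw [e, mul_one_div, div_le_div_iff₀ (by positivity) (by positivity)]
    have : 0 ≤ (n : ℝ) ^ 10 := by positivity
    have h2 := mul_le_mul_of_nonneg_right hn2 this
    linarith
  set B := {ω | ¬ PlantedClustering.IsOptimalSolution r K
    (PlantedClustering.adjacency (G ω)) (PlantedClustering.clusterMatrix C)} with hB
  -- only a cover is used, so `B` need not be shown measurable
  have hcover : (Set.univ : Set Ω) ⊆ (U ∪ V) ∪ B := by
    intro ω _
    by_cases hωU : ω ∈ U
    · exact Or.inl (Or.inl hωU)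
    by_cases hωV : ω ∈ V
    · exact Or.inl (Or.inr hωV)
    refine Or.inr ?_
    simp only [hU, hV, Set.mem_ofPred_eq, not_lt] at hωU hωV
    have hA := PlantedClustering.adjacency_eq_zero_or_one (G ω)
    set A := PlantedClustering.adjacency (G ω) with hAdef
    set S := PlantedClustering.objective A (PlantedClustering.clusterMatrix C) with hS
    set N := ∑ i, ∑ j, PlantedClustering.offCluster C A i j with hN
    have hrK2 : (r : ℝ) * K ^ 2 = r * K * K := by ring
    -- strict, since the diagonal of the adjacency matrix vanishes
    have hSlt : S < r * K * K := by
      have h1 : S = 2 * ∑ e ∈ PlantedClustering.clusterPairs C, A e.1.1 e.1.2 := by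
        rw [hS, PlantedClustering.objective_clusterMatrix_eq, Finset.sum_apply]
        simp only [hAdef, PlantedClustering.adjacency_eq_indicator]
      have h2 : ∑ e ∈ PlantedClustering.clusterPairs C, A e.1.1 e.1.2
          ≤ ∑ _e ∈ PlantedClustering.clusterPairs C, (1 : ℝ) :=
        Finset.sum_le_sum fun e _ => by rcases hA e.1.1 e.1.2 with h | h <;> simp [h]
      have h3 := PlantedClustering.two_mul_card_clusterPairs hC
      simp only [Finset.sum_const, nsmul_eq_mul, mul_one] at h2
      have : (0 : ℝ) < r * K := by positivity
      linarith
    -- the additive deviation `2 L / θ` is small because `log n ≤ K / c₁`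
    have hD : 2 * L / θ = 4400 * Real.log n * y / ε₀ := by
      rw [hL, hθ]; field_simp; norm_num
    have hDK : 2 * L / θ ≤ 44 / 10000 * (ε₀ * K * y) := by
      rw [hD, div_le_iff₀ hε₀]
      have := mul_le_mul_of_nonneg_right hlogK hy0.le
      linarith
    have hDn : 2 * L / θ ≤ 22 / 10000 * (ε₀ * n * y) := by
      have : ε₀ * K * y ≤ ε₀ * (n / 2) * y := by gcongr
      linarith
    rw [hrK2] at hωU hωV
    obtain ⟨hN0, hest⟩ := PlantedClustering.edge_density_estimates (n := n) (K := K) (R := r * K)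
      (N := N) (S := S) hε₀ hε₀' (by linarith) hKrK hrKn (by linarith) (by linarith) hq
      (by linarith) hεy hy2 hpε hgap hKp hθ hDK hDn hωU hωV
    have hv : 0 < √(N / n) := Real.sqrt_pos.mpr (by positivity)
    have hNv : N = n * √(N / n) ^ 2 := by
      rw [Real.sq_sqrt (by positivity)]; field_simp
    obtain ⟨a, t, ha, ht, h1, h2, h3⟩ := PlantedClustering.exists_rates (n := (n : ℝ)) (K := K)
      (R := r * K) (by linarith) (by positivity) hrKn (by linarith) hv hNv hSlt (hest _ hv hNv)
    rw [← hrK2] at h1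
    exact PlantedClustering.not_isOptimalSolution_of_direction hC hK hA ha ht h1 h2 h3
  have h1 : μ.real Set.univ ≤ μ.real U + μ.real V + μ.real B :=
    (measureReal_mono hcover).trans ((measureReal_union_le _ _).trans
      (add_le_add_left (measureReal_union_le _ _) _))
  rw [probReal_univ] at h1
  linarith
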